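/- A \emph{strong bimonoid} is a structure $(B,\oplus,\otimes,\mathbb{0},\mathbb{1})$ such that $(B,\oplus,\mathbb{0})$ is a commutative monoid, $(B,\otimes,\mathbb{1})$ is a monoid, and $\mathbb{0}\otimes b=b\otimes\mathbb{0}=\mathbb{0}$ for every $b\in B$; it is \emph{commutative} if $\otimes$ is commutative, and \emph{strongly zero-sum-free} if for all $a,b,c\in B$ we have $(a\oplus b)\otimes c=\mathbb{0}$ if and only if $a\otimes c=b\otimes c=\mathbb{0}$. A \emph{ranked alphabet} is a finite non-empty set $\Sigma$ with a rank mapping $\mathrm{rk}:\Sigma\to\mathbb{N}$ such that some symbol has rank $0$; write $\Sigma^{(k)}=\mathrm{rk}^{-1}(k)$, and let $\mathrm{T}_\Sigma$ be the set of trees (terms) over $\Sigma$. A \emph{weighted tree automaton} over $\Sigma$ and $B$ is a tuple $\mathcal{A}=(Q,\delta,F)$ with a finite non-empty set $Q$, a family $\delta=(\delta_k)_{k\in\mathbb{N}}$ of mappings $\delta_k:Q^k\times\Sigma^{(k)}\times Q\to B$, and a mapping $F:Q\to B$. Its \emph{initial algebra semantics} is the mapping $[\![\mathcal{A}]\!]^{\mathrm{init}}:\mathrm{T}_\Sigma\to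 B$ given by $[\![\mathcal{A}]\!]^{\mathrm{init}}(\xi)=\bigoplus_{q\in Q}\mathrm{h}(\xi)_q\otimes F_q$, where $\mathrm{h}:\mathrm{T}_\Sigma\to B^Q$ is defined inductively by $$\mathrm{h}(\sigma(\xi_1,\dots,\xi_k))_q=\bigoplus_{q_1\cdots q_k\in Q^k}\Big(\bigotimes_{i=1}^k\mathrm{h}(\xi_i)_{q_i}\Big)\otimes\delta_k(q_1\cdots q_k,\sigma,q),$$ and its \emph{initial algebra support} is $\{\xi\in\mathrm{T}_\Sigma\mid[\![\mathcal{A}]\!]^{\mathrm{init}}(\xi)\neq\mathbb{0}\}$. A tree language $L\subseteq\mathrm{T}_\Sigma$ is \emph{recognizable} if it is the initial algebra support of some weighted tree automaton over $\Sigma$ and the Boolean semiring $(\{0,1\},\vee,\wedge,0,1)$ (equivalently, if it is accepted by a finite-state tree automaton). \textbf{Corollary.} Let $B$ be a strongly zero-sum-free commutative strong bimonoid, $\Sigma$ a ranked alphabet, and $\mathcal{A}$ a weighted tree automaton over $\Sigma$ and $B$. Then the initial algebra support of $\mathcal{A}$ is a recognizable tree language. -/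

import Mathlib

universe u v w

/-- A strong bimonoid: `(B, +, 0)` is a commutative monoid, `(B, *, 1)` is a monoid and `0` is
absorbing for `*`. No distributivity is required. -/
class StrongBimonoid (B : Type v) extends AddCommMonoid B, MonoidWithZero B

/-- The strong bimonoid `B` is strongly zero-sum-free. -/
def StronglyZeroSumFree (B : Type v) [StrongBimonoid B] : Prop :=
  ∀ a b c : B, (a + b) * c = 0 ↔ (a * c = 0 ∧ b * c = 0)

/-- A ranked alphabet: a finite set of symbols with a rank mapping such that some symbol has
rank `0` (in particular the set of symbols is non-empty). -/
structure RankedAlphabet where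
  Symbol : Type u
  finite_symbol : Finite Symbol
  rk : Symbol → ℕ
  exists_nullary : ∃ a : Symbol, rk a = 0

/-- The trees over a ranked alphabet `S`: `node σ ξ` is `σ(ξ₁, …, ξₖ)`, where `k` is the rank
of `σ`. -/
inductive RankedTree (S : RankedAlphabet.{u}) : Type u
  | node (σ : S.Symbol) (ξ : Fin (S.rk σ) → RankedTree S) : RankedTree S

/-- A weighted tree automaton over the ranked alphabet `S` and `B`. The value
`delta σ p q` is the weight `δ_k(p₁ ⋯ pₖ, σ, q)`, where `k` is the rank of `σ`. -/
structure WeightedTreeAutomaton (S : RankedAlphabet.{u}) (B : Type v) where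
  State : Type w
  fintype_state : Fintype State
  nonempty_state : Nonempty State
  delta : (σ : S.Symbol) → (Fin (S.rk σ) → State) → State → B
  rootWeight : State → B

attribute [instance] WeightedTreeAutomaton.fintype_state WeightedTreeAutomaton.nonempty_state

namespace WeightedTreeAutomaton

variable {S : RankedAlphabet.{u}} {B : Type v} [StrongBimonoid B]

/-- The unique homomorphism `h` from the term algebra to the algebra on `B^Q` that the
automaton determines: `h(σ(ξ₁, …, ξₖ))_q` is the sum over all `p₁ ⋯ pₖ` in `Q^k` of
`(h(ξ₁)_{p₁} * ⋯ * h(ξₖ)_{pₖ}) * δ_k(p₁ ⋯ pₖ, σ, q)`, the product being taken in this order. -/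
def hom (A : WeightedTreeAutomaton.{u, v, w} S B) : RankedTree S → A.State → B
  | .node σ ξ => fun q =>
      ∑ p : Fin (S.rk σ) → A.State,
        (List.ofFn fun i => hom A (ξ i) (p i)).prod * A.delta σ p q

/-- The initial algebra semantics of a weighted tree automaton. -/
def initialSem (A : WeightedTreeAutomaton.{u, v, w} S B) (ξ : RankedTree S) : B :=
  ∑ q : A.State, A.hom ξ q * A.rootWeight q

/-- The initial algebra support of a weighted tree automaton. -/
def initialSupport (A : WeightedTreeAutomaton.{u, v, w} S B) : Set (RankedTree S) :=
  Function.support A.initialSem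

end WeightedTreeAutomaton

/-- The carrier of the Boolean semiring; a separate name, since the addition of `Boole` is
disjunction, not the exclusive or. -/
def Boole : Type := Bool

instance : Zero Boole := ⟨Bool.false⟩

instance : One Boole := ⟨Bool.true⟩

instance : Add Boole := ⟨Bool.or⟩

instance : Mul Boole := ⟨Bool.and⟩

/-- The Boolean semiring `({0, 1}, ∨, ∧, 0, 1)` as a strong bimonoid. -/
instance : StrongBimonoid Boole where
  add_assoc := Bool.or_assoc
  zero_add := Bool.false_or
  add_zero := Bool.or_false
  add_comm := Bool.or_comm
  nsmul := nsmulRec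
  mul_assoc := Bool.and_assoc
  one_mul := Bool.true_and
  mul_one := Bool.and_true
  zero_mul := Bool.false_and
  mul_zero := Bool.and_false

/-- A tree language is recognizable if it is the support of a weighted tree automaton over the
Boolean semiring, that is, if it is accepted by a finite-state tree automaton. -/
def IsRecognizable {S : RankedAlphabet.{u}} (L : Set (RankedTree S)) : Prop :=
  ∃ A : WeightedTreeAutomaton.{u, 0, 0} S Boole, L = A.initialSupport

/-! Distributivity is missing, but strong zero-sum-freeness lets sums be expanded whenever only
vanishing matters: a tree is in the support iff one of its runs, completed by a root weight, has
nonzero weight (`hom_mul_eq_zero_iff`). By commutativity, the weight of a run is a monomial in the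
finitely many weights of the automaton. The exponent vectors of vanishing monomials form an upper
set, so by Dickson's lemma their syntactic congruence has finite index. A finite automaton can thus
guess a run and track its state and the class of its exponent vector. -/

/-- Membership in an upper set of `ι → ℕ`, `ι` finite, only depends on the coordinates up to some
threshold (Dickson's lemma). -/
theorem exists_threshold_of_isUpperSet {ι : Type*} [Finite ι] {I : Set (ι → ℕ)}
    (hI : IsUpperSet I) : ∃ k : ι → ℕ, ∀ e, e ⊓ k ∈ I ↔ e ∈ I := by
  have hfin : {e | Minimal (· ∈ I) e}.Finite :=
    WellQuasiOrderedLE.finite_of_isAntichain (setOfPred_minimal_antichain _)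
  obtain ⟨k, hk⟩ := hfin.bddAbove
  refine ⟨k, fun e => ⟨hI inf_le_left, fun he => ?_⟩⟩
  obtain ⟨m, hme, hm⟩ := exists_minimal_le_of_wellFoundedLT (· ∈ I) e he
  exact hI (le_inf hme (hk hm)) hm.prop

/-- The syntactic congruence of a subset of an additive commutative monoid. -/
def AddCon.syntactic {M : Type*} [AddCommMonoid M] (I : Set M) : AddCon M where
  r a b := ∀ c, a + c ∈ I ↔ b + c ∈ I
  iseqv := ⟨fun _ _ => Iff.rfl, fun h c => (h c).symm, fun h h' c => (h c).trans (h' c)⟩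
  add' {a b a' b'} h h' c := by
    rw [add_assoc, h, add_left_comm, h', add_left_comm, ← add_assoc]

theorem AddCon.syntactic_iff {M : Type*} [AddCommMonoid M] {I : Set M} {a b : M} :
    AddCon.syntactic I a b ↔ ∀ c, a + c ∈ I ↔ b + c ∈ I := Iff.rfl

/-- Truncating at the threshold `k` does not change the class of a vector, so the finitely many
vectors below `k` represent all classes. -/
theorem AddCon.finite_quotient_syntactic {ι : Type*} [Finite ι] {I : Set (ι → ℕ)}
    (hI : IsUpperSet I) : Finite (AddCon.syntactic I).Quotient := by
  obtain ⟨k, hk⟩ := exists_threshold_of_isUpperSet hI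
  have : Finite (Set.Iic k) := by
    have := Fintype.ofFinite ι
    classical exact (Set.finite_Iic k).to_subtype
  refine Finite.of_surjective
    (fun e : Set.Iic k => ((e : ι → ℕ) : (AddCon.syntactic I).Quotient)) fun x => ?_
  induction x using AddCon.induction_on with | _ e =>
  refine ⟨⟨e ⊓ k, Set.mem_Iic.2 inf_le_right⟩, (AddCon.eq _).2 (AddCon.syntactic_iff.2 fun c => ?_)⟩
  rw [← hk, ← hk (e + c)]
  suffices h : (e ⊓ k + c) ⊓ k = (e + c) ⊓ k by rw [h]
  ext i
  simp only [Pi.inf_apply, Pi.add_apply]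
  omega

theorem StronglyZeroSumFree.sum_mul_eq_zero_iff {B : Type*} [StrongBimonoid B]
    (hB : StronglyZeroSumFree B) {ι : Type*} (s : Finset ι) (f : ι → B) (c : B) :
    (∑ i ∈ s, f i) * c = 0 ↔ ∀ i ∈ s, f i * c = 0 := by
  classical
  induction s using Finset.induction_on with
  | empty => simp
  | insert a s ha ih => rw [Finset.sum_insert ha, hB, ih, Finset.forall_mem_insert]

/-- If annihilating `a i` means annihilating each element of `s i`, then annihilating the product
of the `a i` means annihilating each product of elements of the `s i`. -/
theorem prod_mul_eq_zero_iff_forall_mem {B : Type*} [CommMonoidWithZero B] {n : ℕ}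
    (a : Fin n → B) {E : Type*} (ev : E → B) (s : Fin n → Set E)
    (h : ∀ i c, a i * c = 0 ↔ ∀ e ∈ s i, ev e * c = 0) (c : B) :
    (∏ i, a i) * c = 0 ↔ ∀ f : Fin n → E, (∀ i, f i ∈ s i) → (∏ i, ev (f i)) * c = 0 := by
  induction n generalizing c with
  | zero => simp
  | succ n ih =>
    simp only [Fin.prod_univ_succ, mul_assoc, h, Fin.forall_fin_succ_pi, Fin.forall_fin_succ,
      Fin.cons_zero, Fin.cons_succ]
    refine forall_congr' fun e => ?_
    -- Commutativity moves the head factor into the multiplier, so `ih` applies with `ev e * c` in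
    -- place of `c`.
    simp only [mul_left_comm (ev e)]
    constructor
    · rintro H f ⟨he, hf⟩
      exact (ih _ _ (fun i => h i.succ) _).1 (H he) f hf
    · intro H he
      exact (ih _ _ (fun i => h i.succ) _).2 fun f hf => H f ⟨he, hf⟩

theorem Boole.add_ne_zero_iff (a b : Boole) : a + b ≠ 0 ↔ a ≠ 0 ∨ b ≠ 0 := by
  have h : ∀ a b : Bool, ¬ Bool.or a b = false ↔ ¬ a = false ∨ ¬ b = false := by decide
  exact h a b

theorem Boole.mul_ne_zero_iff (a b : Boole) : a * b ≠ 0 ↔ a ≠ 0 ∧ b ≠ 0 := by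
  have h : ∀ a b : Bool, ¬ Bool.and a b = false ↔ ¬ a = false ∧ ¬ b = false := by decide
  exact h a b

theorem Boole.one_ne_zero : (1 : Boole) ≠ 0 := Bool.noConfusion

theorem Boole.sum_ne_zero_iff {ι : Type*} (s : Finset ι) (f : ι → Boole) :
    ∑ i ∈ s, f i ≠ 0 ↔ ∃ i ∈ s, f i ≠ 0 := by
  classical
  induction s using Finset.induction_on with
  | empty => simp
  | insert a s ha ih =>
    rw [Finset.sum_insert ha, Boole.add_ne_zero_iff, ih, Finset.exists_mem_insert]

theorem Boole.list_prod_ne_zero_iff (l : List Boole) : l.prod ≠ 0 ↔ ∀ a ∈ l, a ≠ 0 := by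
  induction l with
  | nil => simp [Boole.one_ne_zero]
  | cons a l ih => rw [List.prod_cons, Boole.mul_ne_zero_iff, ih, List.forall_mem_cons]

/-- A tree language accepted by a finite-state tree automaton, given by its transition relation
`R`, its final states `T`, and its reachability relation, is recognizable. -/
theorem isRecognizable_of_transition {S : RankedAlphabet.{u}} {Q : Type*} [Finite Q] [Nonempty Q]
    (R : (σ : S.Symbol) → (Fin (S.rk σ) → Q) → Q → Prop) (T : Set Q)
    (reach : RankedTree S → Q → Prop)
    (hreach : ∀ σ ξ q, reach (.node σ ξ) q ↔ ∃ p, (∀ i, reach (ξ i) (p i)) ∧ R σ p q) :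
    IsRecognizable {ξ | ∃ q, reach ξ q ∧ q ∈ T} := by
  classical
  -- `Q` may live in any universe, whereas `IsRecognizable` asks for states in `Type`.
  obtain ⟨n, ⟨φ⟩⟩ := Finite.exists_equiv_fin Q
  let A : WeightedTreeAutomaton.{u, 0, 0} S Boole :=
    { State := Fin n
      fintype_state := inferInstance
      nonempty_state := φ.symm.nonempty
      delta := fun σ p q => if R σ (φ.symm ∘ p) (φ.symm q) then 1 else 0
      rootWeight := fun q => if φ.symm q ∈ T then 1 else 0 }
  have key : ∀ ξ (q : Fin n), A.hom ξ q ≠ 0 ↔ reach ξ (φ.symm q) := by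
    intro ξ
    induction ξ with | node σ ξ ih =>
    intro q
    rw [WeightedTreeAutomaton.hom, Boole.sum_ne_zero_iff, hreach,
      ← (Equiv.arrowCongr (Equiv.refl (Fin (S.rk σ))) φ.symm).exists_congr_right]
    refine exists_congr fun p => ?_
    refine (and_iff_right (Finset.mem_univ p)).trans ?_
    rw [Boole.mul_ne_zero_iff, Boole.list_prod_ne_zero_iff, List.forall_mem_ofFn_iff]
    refine and_congr (forall_congr' fun i => ih i (p i)) ?_
    simp [A, Boole.one_ne_zero, Function.comp_def, Equiv.arrowCongr]
  refine ⟨A, Set.ext fun ξ => ?_⟩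
  rw [WeightedTreeAutomaton.initialSupport, Function.mem_support,
    WeightedTreeAutomaton.initialSem, Boole.sum_ne_zero_iff, Set.mem_ofPred_eq,
    ← φ.symm.exists_congr_right]
  refine exists_congr fun q => ?_
  rw [Boole.mul_ne_zero_iff, key]
  simp [A, Boole.one_ne_zero]

namespace WeightedTreeAutomaton

/-- The index type of all weights of an automaton: transitions and root weights. -/
abbrev WeightIndex {S : RankedAlphabet.{u}} {B : Type v} (A : WeightedTreeAutomaton.{u, v, w} S B) :
    Type (max u w) :=
  (Σ σ : S.Symbol, (Fin (S.rk σ) → A.State) × A.State) ⊕ A.State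

/-- The weight with a given index. -/
def weight {S : RankedAlphabet.{u}} {B : Type v} (A : WeightedTreeAutomaton.{u, v, w} S B) :
    A.WeightIndex → B :=
  Sum.elim (fun t => A.delta t.1 t.2.1 t.2.2) A.rootWeight

open Classical in
/-- The runs of an automaton on a tree that end in a given state, each represented by the number
of times it uses each of the weights. -/
def runCounts {S : RankedAlphabet.{u}} {B : Type v} (A : WeightedTreeAutomaton.{u, v, w} S B) :
    RankedTree S → A.State → Set (A.WeightIndex → ℕ)
  | .node σ ξ => fun q => {e |
      ∃ (p : Fin (S.rk σ) → A.State) (f : Fin (S.rk σ) → A.WeightIndex → ℕ), (∀ i, f i ∈ runCounts A (ξ i) (p i)) ∧ e = ∑ i, f i + Pi.single (.inl ⟨σ, p, q⟩) 1}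

end WeightedTreeAutomaton

/-- The monomial with exponents `e`, evaluated at `x`. -/
def monomialEval {ι B : Type*} [Fintype ι] [CommMonoid B] (x : ι → B) (e : ι → ℕ) : B :=
  ∏ i, x i ^ e i

section monomialEval

variable {ι B : Type*} [Fintype ι]

theorem monomialEval_add [CommMonoid B] (x : ι → B) (e f : ι → ℕ) :
    monomialEval x (e + f) = monomialEval x e * monomialEval x f := by
  simp [monomialEval, pow_add, Finset.prod_mul_distrib]

theorem monomialEval_sum [CommMonoid B] (x : ι → B) {κ : Type*} [Fintype κ] (f : κ → ι → ℕ) :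
    monomialEval x (∑ k, f k) = ∏ k, monomialEval x (f k) := by
  simp only [monomialEval, Finset.sum_apply, ← Finset.prod_pow_eq_pow_sum]
  exact Finset.prod_comm

theorem monomialEval_single [CommMonoid B] [DecidableEq ι] (x : ι → B) (i : ι) :
    monomialEval x (Pi.single i 1) = x i := by
  rw [monomialEval, Finset.prod_eq_single i]
  · simp
  · intro j _ hj
    simp [hj]
  · simp

theorem isUpperSet_monomialEval_eq_zero [CommMonoidWithZero B] (x : ι → B) :
    IsUpperSet {e | monomialEval x e = 0} := by
  intro e f hef he
  obtain ⟨g, rfl⟩ := exists_add_of_le hef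
  rw [Set.mem_ofPred_eq] at he ⊢
  rw [monomialEval_add, he, zero_mul]

end monomialEval

/-- A commutative strong bimonoid as a commutative monoid with zero. -/
abbrev StrongBimonoid.commMonoidWithZero {B : Type v} [StrongBimonoid B]
    (hcomm : ∀ a b : B, a * b = b * a) : CommMonoidWithZero B where
  mul_comm := hcomm

/-- In the presence of strong zero-sum-freeness, annihilating the value at a state amounts to
annihilating the weight of each run that ends in this state. -/
theorem WeightedTreeAutomaton.hom_mul_eq_zero_iff {B : Type v} [StrongBimonoid B]
    (hcomm : ∀ a b : B, a * b = b * a) (hB : StronglyZeroSumFree B)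
    {S : RankedAlphabet.{u}} (A : WeightedTreeAutomaton.{u, v, w} S B) [Fintype A.WeightIndex]
    (ξ : RankedTree S) (q : A.State) (c : B) :
    letI := StrongBimonoid.commMonoidWithZero hcomm
    A.hom ξ q * c = 0 ↔ ∀ e ∈ A.runCounts ξ q, monomialEval A.weight e * c = 0 := by
  classical
  let := StrongBimonoid.commMonoidWithZero hcomm
  induction ξ generalizing q c with | node σ ξ ih =>
  rw [hom, hB.sum_mul_eq_zero_iff]
  simp only [runCounts, Set.mem_ofPred_eq, forall_exists_index, and_imp, Finset.mem_univ,
    forall_true_left]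
  rw [forall_comm]
  refine forall_congr' fun p => ?_
  rw [List.prod_ofFn, mul_assoc]
  refine (prod_mul_eq_zero_iff_forall_mem _ (monomialEval A.weight)
    (fun i => A.runCounts (ξ i) (p i)) (fun i c => ih i (p i) c) _).trans ?_
  rw [forall_comm]
  refine forall_congr' fun f => ?_
  constructor
  · rintro H e hf rfl
    rw [monomialEval_add, monomialEval_sum, monomialEval_single, mul_assoc]
    exact H hf
  · intro H hf
    have := H _ hf rfl
    rwa [monomialEval_add, monomialEval_sum, monomialEval_single, mul_assoc] at this

theorem mainTheorem10 {B : Type v} [StrongBimonoid B]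
    (hcomm : ∀ a b : B, a * b = b * a) (hB : StronglyZeroSumFree B)
    (S : RankedAlphabet.{u}) (A : WeightedTreeAutomaton.{u, v, w} S B) :
    IsRecognizable A.initialSupport := by
  classical
  let := StrongBimonoid.commMonoidWithZero hcomm
  have := S.finite_symbol
  let : Fintype A.WeightIndex := Fintype.ofFinite _
  let I : Set (A.WeightIndex → ℕ) := {e | monomialEval A.weight e = 0}
  let C := AddCon.syntactic I
  have : Finite C.Quotient :=
    AddCon.finite_quotient_syntactic (isUpperSet_monomialEval_eq_zero A.weight)
  let π : (A.WeightIndex → ℕ) →+ C.Quotient := C.mk'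
  have key := isRecognizable_of_transition (S := S) (Q := A.State × C.Quotient)
    (fun σ p q => q.2 = ∑ i, (p i).2 + π (Pi.single (.inl ⟨σ, fun i => (p i).1, q.1⟩) 1))
    {q | ∃ e, π e = q.2 ∧ monomialEval A.weight e * A.rootWeight q.1 ≠ 0}
    (fun ξ q => ∃ e ∈ A.runCounts ξ q.1, π e = q.2) ?_
  · convert key using 1
    ext ξ
    have hsum := hB.sum_mul_eq_zero_iff Finset.univ (fun q => A.hom ξ q * A.rootWeight q) 1
    rw [WeightedTreeAutomaton.initialSupport, Function.mem_support,
      WeightedTreeAutomaton.initialSem]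
    simp only [mul_one, Finset.mem_univ, forall_true_left,
      A.hom_mul_eq_zero_iff hcomm hB] at hsum
    rw [ne_eq, hsum]
    push Not
    constructor
    · rintro ⟨q, e, he, hne⟩
      exact ⟨(q, π e), ⟨e, he, rfl⟩, e, rfl, hne⟩
    · rintro ⟨⟨q, _⟩, ⟨e, he, rfl⟩, e', he', hne⟩
      refine ⟨q, e, he, fun h0 => hne ?_⟩
      -- Acceptance does not depend on the representative: the root weight is itself one of the
      -- variables, so multiplying by it is a shift of the exponent vector, which the congruence
      -- respects.
      have := AddCon.syntactic_iff.1 ((AddCon.eq C).1 he') (Pi.single (.inr q) 1)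
      simp only [I, Set.mem_ofPred_eq, monomialEval_add, monomialEval_single] at this
      exact this.2 h0
  · rintro σ ξ ⟨q, m⟩
    constructor
    · rintro ⟨_, ⟨p, f, hf, rfl⟩, hm⟩
      refine ⟨fun i => (p i, π (f i)), fun i => ⟨f i, hf i, rfl⟩, ?_⟩
      rw [← hm, map_add, map_sum]
    · rintro ⟨p, hp, hm⟩
      choose f hf hfp using hp
      refine ⟨_, ⟨fun i => (p i).1, f, hf, rfl⟩, ?_⟩
      rw [map_add, map_sum, hm]
      simp only [hfp]
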